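/- Let $D$ be an integral domain with quotient field $K$, and let $\mathbf{F}(D)$ be the set of nonzero fractional ideals of $D$, i.e. of nonzero $D$-submodules $A$ of $K$ with $rA\subseteq D$ for some $0\neq r\in D$. A (classical) star operation on $D$ is a map $\star:\mathbf{F}(D)\to\mathbf{F}(D)$, $A\mapsto A^\star$, such that for all $0\neq x\in K$ and $A,B\in\mathbf{F}(D)$: (1) $(x)^\star=(x)$ and $(xA)^\star=xA^\star$; (2) $A\subseteq A^\star$, and $A\subseteq B$ implies $A^\star\subseteq B^\star$; (3) $(A^\star)^\star=A^\star$. It is of finite type if, for every $A\in\mathbf{F}(D)$, $A^\star$ is the union of the sets $B^\star$, where $B$ ranges over the nonzero finitely generated fractional ideals of $D$ contained in $A$. The Zariski topology on the set $\operatorname{Star}(D)$ of all star operations on $D$ is the topology with subbasic open sets $U_F=\{\star\in\operatorname{Star}(D)\mid 1\in F^\star\}$, $F\in\mathbf{F}(D)$. Then the set $\operatorname{Star}_f(D)$ of star operations of finite type on $D$, with the subspace topology induced by the Zariski topology of $\operatorname{Star}(D)$, is a spectral space: it is quasi-compact and $T_0$, its quasi-compact open subsets are closed under finite intersections and form a basis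 of the topology, and every nonempty irreducible closed subset is the closure of a unique point. -/

import Mathlib

open scoped nonZeroDivisors

/-- The set `F(D)` of nonzero fractional ideals of `D` in its quotient field `K`. -/
abbrev NonzeroFractionalIdeal (D K : Type*) [CommRing D] [Field K] [Algebra D K] : Type _ :=
  {A : FractionalIdeal D⁰ K // A ≠ 0}

namespace NonzeroFractionalIdeal

variable {D K : Type*} [CommRing D] [Field K] [Algebra D K] [IsFractionRing D K]

/-- The principal fractional ideal `(x) = xD`, for `x ≠ 0`. -/
noncomputable def principal (x : K) (hx : x ≠ 0) : NonzeroFractionalIdeal D K :=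
  ⟨FractionalIdeal.spanSingleton D⁰ x, FractionalIdeal.spanSingleton_ne_zero_iff.mpr hx⟩

/-- The fractional ideal `xA`, for `x ≠ 0`. -/
noncomputable def scale (x : K) (hx : x ≠ 0) (A : NonzeroFractionalIdeal D K) :
    NonzeroFractionalIdeal D K :=
  ⟨FractionalIdeal.spanSingleton D⁰ x * A.1, fun h => A.2 (by
    rw [FractionalIdeal.eq_zero_iff] at h ⊢
    intro a ha
    exact (mul_eq_zero.mp (h (x * a)
      (FractionalIdeal.mem_singleton_mul.mpr ⟨a, ha, rfl⟩))).resolve_left hx)⟩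

/-- `xA` is the set of all `x * a` with `a ∈ A`. -/
theorem mem_scale_iff (x : K) (hx : x ≠ 0) (A : NonzeroFractionalIdeal D K) (y : K) :
    y ∈ (scale x hx A).1 ↔ ∃ a ∈ A.1, y = x * a :=
  FractionalIdeal.mem_singleton_mul

end NonzeroFractionalIdeal

/-- A (classical) star operation on the integral domain `D` with quotient field `K`. -/
structure ClassicalStarOperation (D K : Type*) [CommRing D] [IsDomain D] [Field K] [Algebra D K]
    [IsFractionRing D K] where
  /-- The underlying map `A ↦ A^⋆`. -/
  toFun : NonzeroFractionalIdeal D K → NonzeroFractionalIdeal D K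
  map_principal : ∀ (x : K) (hx : x ≠ 0),
    toFun (NonzeroFractionalIdeal.principal x hx) = NonzeroFractionalIdeal.principal x hx
  map_scale : ∀ (x : K) (hx : x ≠ 0) (A : NonzeroFractionalIdeal D K),
    toFun (NonzeroFractionalIdeal.scale x hx A) = NonzeroFractionalIdeal.scale x hx (toFun A)
  le_map : ∀ A : NonzeroFractionalIdeal D K, A ≤ toFun A
  mono : ∀ A B : NonzeroFractionalIdeal D K, A ≤ B → toFun A ≤ toFun B
  idem : ∀ A : NonzeroFractionalIdeal D K, toFun (toFun A) = toFun A

namespace ClassicalStarOperation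

variable {D K : Type*} [CommRing D] [IsDomain D] [Field K] [Algebra D K] [IsFractionRing D K]

/-- `A^{⋆_f}`: the union of the `B^⋆` over the nonzero finitely generated fractional ideals
`B ⊆ A`. -/
def finiteTypeHull (s : ClassicalStarOperation D K) (A : NonzeroFractionalIdeal D K) : Set K :=
  {x : K | ∃ B : NonzeroFractionalIdeal D K,
    (B.1 : Submodule D K).FG ∧ B ≤ A ∧ x ∈ (s.toFun B).1}

/-- `⋆` is of finite type if `⋆ = ⋆_f`, that is `A^⋆ = A^{⋆_f}` for every nonzero
fractional ideal `A`. -/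
def IsFiniteType (s : ClassicalStarOperation D K) : Prop :=
  ∀ A : NonzeroFractionalIdeal D K, {x : K | x ∈ (s.toFun A).1} = s.finiteTypeHull A

/-- The Zariski topology on `Star(D)`, with subbasic open sets `U_F = {⋆ | 1 ∈ F^⋆}`, where
`F` ranges over all nonzero fractional ideals. -/
instance zariskiTopology : TopologicalSpace (ClassicalStarOperation D K) :=
  TopologicalSpace.generateFrom
    {U : Set (ClassicalStarOperation D K) | ∃ F : NonzeroFractionalIdeal D K,
      U = {s : ClassicalStarOperation D K | (1 : K) ∈ (s.toFun F).1}}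

end ClassicalStarOperation

/-- The set `Star_f(D)` of star operations of finite type, with the subspace topology of the
Zariski topology. -/
abbrev FiniteTypeStarOperation (D K : Type*) [CommRing D] [IsDomain D] [Field K] [Algebra D K]
    [IsFractionRing D K] : Type _ :=
  {s : ClassicalStarOperation D K // s.IsFiniteType}

/-! A finite type operation is determined by its values on finitely generated ideals, and the sets
`U_F` with `F` finitely generated already form a subbasis of `Star_f(D)`. Spectrality thus reduces
to an ultrafilter criterion: each ultrafilter needs a limit operation lying in exactly those `U_F`
that belong to it. The operation `limit` takes eventual membership on finitely generated ideals and
extends by directed union. Finite generation is what makes it idempotent, since finitely many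
eventual conditions hold simultaneously. -/

open Filter Topology TopologicalSpace

/-! ### Ultrafilter criterion for spectrality -/

/-- A `T₀` space with a subbasis `S` such that every ultrafilter `U` has a limit point lying in
exactly those members of `S` that belong to `U`, is spectral. -/
theorem SpectralSpace.of_forall_ultrafilter {X : Type*} [t : TopologicalSpace X] [T0Space X]
    {S : Set (Set X)} (hS : t = generateFrom S)
    (h : ∀ U : Ultrafilter X, ∃ x, ∀ s ∈ S, x ∈ s ↔ s ∈ U) : SpectralSpace X := by
  choose lim hlim using h
  have hle : ∀ U : Ultrafilter X, ↑U ≤ 𝓝 (lim U) := fun U => by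
    rw [hS, nhds_generateFrom]
    refine le_iInf₂ fun s hs => ?_
    exact le_principal_iff.mpr ((hlim U s hs.2).mp hs.1)
  have hbasis := isTopologicalBasis_of_subbasis hS
  have hmem : ∀ f : Set (Set X), f ⊆ S → ∀ U : Ultrafilter X, ⋂₀ f ∈ U → lim U ∈ ⋂₀ f :=
    fun f hf U hU s hs => (hlim U s (hf hs)).mpr (mem_of_superset hU (Set.sInter_subset_of_mem hs))
  -- The family `f` may be infinite or empty; the empty one yields compactness of `X`.
  have hcompact : ∀ f : Set (Set X), f ⊆ S → IsCompact (⋂₀ f) := fun f hf => by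
    rw [isCompact_iff_ultrafilter_le_nhds]
    exact fun U hU => ⟨lim U, hmem f hf U (le_principal_iff.mp hU), hle U⟩
  have : CompactSpace X := ⟨by simpa using hcompact ∅ (Set.empty_subset _)⟩
  have : PrespectralSpace X := .of_isTopologicalBasis hbasis (by
    rintro _ ⟨f, hf, rfl⟩
    exact hcompact f hf.2)
  have : QuasiSeparatedSpace X := by
    refine .of_isTopologicalBasis
      (b := fun f : {f : Set (Set X) | f.Finite ∧ f ⊆ S} => ⋂₀ f.1) ?_ fun f g => ?_
    · rwa [Set.image_eq_range] at hbasis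
    · rw [← Set.sInter_union]
      exact hcompact _ (Set.union_subset f.2.2 g.2.2)
  have : QuasiSober X := ⟨fun {C} hC hC' => by
    -- Irreducibility gives the finite intersection property for `C` together with all subbasic sets
    -- meeting it. The limit of the resulting ultrafilter is the generic point.
    obtain ⟨U, hU⟩ := Ultrafilter.exists_ultrafilter_of_finite_inter_nonempty
      (insert C {s | s ∈ S ∧ (C ∩ s).Nonempty}) fun T hT => by
        classical
        refine ((isIrreducible_iff_sInter.mp hC) (T.filter (fun s => s ∈ S ∧ (C ∩ s).Nonempty))
          (fun u hu => ?_) (fun u hu => (Finset.mem_filter.mp hu).2.2)).mono ?_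
        · rw [hS]
          exact isOpen_generateFrom_of_mem (Finset.mem_filter.mp hu).2.1
        · rintro x ⟨hx, hx'⟩ s hs
          rcases hT hs with rfl | hs'
          · exact hx
          · exact hx' s (by simpa using ⟨hs, hs'⟩)
    have hCU : C ∈ U := hU (Set.mem_insert _ _)
    refine ⟨lim U, isGenericPoint_iff_forall_closed hC'
      (isClosed_iff_ultrafilter.mp hC' _ U (hle U) hCU) |>.mpr fun Z hZ hxZ y hy => ?_⟩
    -- A basic neighbourhood of `y ∈ C` missing `Z` is cut out by subbasic sets meeting `C`, hence
    -- belonging to `U`, so it would contain `lim U ∈ Z`.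
    by_contra hyZ
    obtain ⟨_, ⟨f, ⟨-, hf⟩, rfl⟩, hyf, hfZ⟩ :=
      hbasis.exists_subset_of_mem_open (show y ∈ Zᶜ from hyZ) hZ.isOpen_compl
    exact hfZ (fun s hs => (hlim U s (hf hs)).mpr
      (hU (Set.mem_insert_of_mem _ ⟨hf hs, y, hy, hyf s hs⟩))) hxZ⟩
  exact {}

/-! ### Nonzero fractional ideals -/

namespace NonzeroFractionalIdeal

variable {D K : Type*} [CommRing D] [Field K] [Algebra D K]

theorem exists_mem_ne_zero (A : NonzeroFractionalIdeal D K) : ∃ x ∈ A.1, x ≠ 0 := by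
  by_contra! h
  exact A.2 (FractionalIdeal.eq_zero_iff.mpr h)

/-- The sum of two nonzero fractional ideals. -/
noncomputable def add (A B : NonzeroFractionalIdeal D K) : NonzeroFractionalIdeal D K :=
  ⟨A.1 ⊔ B.1, fun h => A.2 (FractionalIdeal.le_zero_iff.mp (le_sup_left.trans_eq h))⟩

theorem le_add_left (A B : NonzeroFractionalIdeal D K) : A ≤ A.add B :=
  (le_sup_left : A.1 ≤ A.1 ⊔ B.1)

theorem le_add_right (A B : NonzeroFractionalIdeal D K) : B ≤ A.add B :=
  (le_sup_right : B.1 ≤ A.1 ⊔ B.1)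

theorem add_le {A B C : NonzeroFractionalIdeal D K} (hA : A ≤ C) (hB : B ≤ C) : A.add B ≤ C :=
  (sup_le hA hB : A.1 ⊔ B.1 ≤ C.1)

theorem fg_add {A B : NonzeroFractionalIdeal D K} (hA : (A.1 : Submodule D K).FG)
    (hB : (B.1 : Submodule D K).FG) : ((A.add B).1 : Submodule D K).FG := by
  rw [add, FractionalIdeal.coe_sup]
  exact hA.sup hB

variable [IsFractionRing D K]

theorem mem_scale_iff_inv_mul_mem {x : K} (hx : x ≠ 0) {A : NonzeroFractionalIdeal D K} {y : K} :
    y ∈ (scale x hx A).1 ↔ x⁻¹ * y ∈ A.1 := by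
  rw [mem_scale_iff]
  constructor
  · rintro ⟨a, ha, rfl⟩
    rwa [inv_mul_cancel_left₀ hx]
  · exact fun h => ⟨_, h, (mul_inv_cancel_left₀ hx y).symm⟩

theorem scale_inv_scale {x : K} (hx : x ≠ 0) (A : NonzeroFractionalIdeal D K) :
    scale x⁻¹ (inv_ne_zero hx) (scale x hx A) = A := by
  refine Subtype.ext (FractionalIdeal.ext fun y => ?_)
  rw [mem_scale_iff_inv_mul_mem, mem_scale_iff_inv_mul_mem, inv_inv, inv_mul_cancel_left₀ hx]

theorem scale_mono {x : K} (hx : x ≠ 0) {A B : NonzeroFractionalIdeal D K} (h : A ≤ B) :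
    scale x hx A ≤ scale x hx B := fun y hy => by
  have hy' : y ∈ (scale x hx A).1 := hy
  rw [mem_scale_iff_inv_mul_mem] at hy'
  exact (mem_scale_iff_inv_mul_mem hx).mpr (h hy')

theorem fg_scale {x : K} (hx : x ≠ 0) {A : NonzeroFractionalIdeal D K}
    (h : (A.1 : Submodule D K).FG) : ((scale x hx A).1 : Submodule D K).FG := by
  rw [scale, FractionalIdeal.coe_mul, FractionalIdeal.coe_spanSingleton]
  exact (Submodule.fg_span_singleton x).mul h

theorem fg_principal {x : K} (hx : x ≠ 0) :
    ((principal x hx : NonzeroFractionalIdeal D K).1 : Submodule D K).FG := by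
  rw [principal, FractionalIdeal.coe_spanSingleton]
  exact Submodule.fg_span_singleton x

theorem mem_principal_self {x : K} (hx : x ≠ 0) :
    x ∈ (principal x hx : NonzeroFractionalIdeal D K).1 :=
  FractionalIdeal.mem_spanSingleton_self _ _

theorem principal_le_iff {x : K} (hx : x ≠ 0) {A : NonzeroFractionalIdeal D K} :
    principal x hx ≤ A ↔ x ∈ A.1 :=
  FractionalIdeal.spanSingleton_le_iff_mem

theorem exists_fg_le (A : NonzeroFractionalIdeal D K) :
    ∃ B : NonzeroFractionalIdeal D K, (B.1 : Submodule D K).FG ∧ B ≤ A := by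
  obtain ⟨x, hxA, hx⟩ := A.exists_mem_ne_zero
  exact ⟨principal x hx, fg_principal hx, (principal_le_iff hx).mpr hxA⟩

theorem exists_le_principal [IsDomain D] (A : NonzeroFractionalIdeal D K) :
    ∃ (x : K) (hx : x ≠ 0), A ≤ principal x hx := by
  obtain ⟨a, ha, h⟩ := A.1.isFractional
  have ha' : algebraMap D K a ≠ 0 :=
    IsLocalization.to_map_ne_zero_of_mem_nonZeroDivisors K le_rfl ha
  refine ⟨(algebraMap D K a)⁻¹, inv_ne_zero ha', fun y hy => ?_⟩
  obtain ⟨d, hd⟩ := h y hy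
  refine (FractionalIdeal.mem_spanSingleton D⁰).mpr ⟨d, ?_⟩
  rw [Algebra.smul_def, hd, Algebra.smul_def, mul_comm, inv_mul_cancel_left₀ ha']

end NonzeroFractionalIdeal

/-! ### Limits of star operations along a filter -/

namespace ClassicalStarOperation

open NonzeroFractionalIdeal

variable {D K : Type*} [CommRing D] [IsDomain D] [Field K] [Algebra D K] [IsFractionRing D K]

theorem toFun_injective :
    Function.Injective (toFun : ClassicalStarOperation D K → _) := by
  rintro ⟨⟩ ⟨⟩ h
  congr

theorem toFun_le_principal (s : ClassicalStarOperation D K) {A : NonzeroFractionalIdeal D K}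
    {x : K} {hx : x ≠ 0} (h : A ≤ principal x hx) : s.toFun A ≤ principal x hx :=
  (s.mono _ _ h).trans_eq (s.map_principal x hx)

theorem mem_toFun_iff_one_mem (s : ClassicalStarOperation D K) (A : NonzeroFractionalIdeal D K)
    {x : K} (hx : x ≠ 0) :
    x ∈ (s.toFun A).1 ↔ (1 : K) ∈ (s.toFun (scale x⁻¹ (inv_ne_zero hx) A)).1 := by
  rw [s.map_scale, mem_scale_iff_inv_mul_mem, inv_inv, mul_one]

section Limit

variable (l : Filter (ClassicalStarOperation D K))

/-- The elements lying in `B^⋆` eventually along `l`, for some finitely generated `B ⊆ A`. -/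
def limitSubmodule (A : NonzeroFractionalIdeal D K) : Submodule D K where
  carrier := {x | ∃ B : NonzeroFractionalIdeal D K,
    (B.1 : Submodule D K).FG ∧ B ≤ A ∧ ∀ᶠ s in l, x ∈ (toFun s B).1}
  zero_mem' := by
    obtain ⟨B, hB, hBA⟩ := A.exists_fg_le
    exact ⟨B, hB, hBA, .of_forall fun s => (toFun s B).1.zero_mem⟩
  add_mem' := by
    rintro x y ⟨B, hB, hBA, hx⟩ ⟨C, hC, hCA, hy⟩
    refine ⟨B.add C, fg_add hB hC, add_le hBA hCA, ?_⟩
    filter_upwards [hx, hy] with s hxs hys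
    exact Submodule.add_mem ((toFun s (B.add C)).1 : Submodule D K)
      (s.mono _ _ (le_add_left B C) hxs) (s.mono _ _ (le_add_right B C) hys)
  smul_mem' := by
    rintro d x ⟨B, hB, hBA, hx⟩
    exact ⟨B, hB, hBA, hx.mono fun s hxs =>
      Submodule.smul_mem ((toFun s B).1 : Submodule D K) d hxs⟩

variable {l}

theorem mem_limitSubmodule {A : NonzeroFractionalIdeal D K} {x : K} :
    x ∈ limitSubmodule l A ↔ ∃ B : NonzeroFractionalIdeal D K,
      (B.1 : Submodule D K).FG ∧ B ≤ A ∧ ∀ᶠ s in l, x ∈ (toFun s B).1 :=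
  Iff.rfl

theorem limitSubmodule_mono {A B : NonzeroFractionalIdeal D K} (h : A ≤ B) :
    limitSubmodule l A ≤ limitSubmodule l B :=
  fun _ ⟨C, hC, hCA, hx⟩ => ⟨C, hC, hCA.trans h, hx⟩

theorem mem_limitSubmodule_of_fg {A : NonzeroFractionalIdeal D K}
    (hA : (A.1 : Submodule D K).FG) {x : K} :
    x ∈ limitSubmodule l A ↔ ∀ᶠ s in l, x ∈ (toFun s A).1 :=
  ⟨fun ⟨_, _, hBA, hx⟩ => hx.mono fun s hxs => s.mono _ _ hBA hxs,
    fun hx => ⟨A, hA, le_rfl, hx⟩⟩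

theorem le_limitSubmodule (A : NonzeroFractionalIdeal D K) :
    (A.1 : Submodule D K) ≤ limitSubmodule l A := fun x hx => by
  by_cases hx0 : x = 0
  · exact hx0 ▸ Submodule.zero_mem _
  · exact ⟨principal x hx0, fg_principal hx0, (principal_le_iff hx0).mpr hx,
      .of_forall fun s => s.le_map _ (mem_principal_self hx0)⟩

/-- Star operations fix principal ideals, and properness of `l` supplies one operation to test. This
gives both fractionality of the limit and its value on principal ideals. -/
theorem limitSubmodule_le_principal [l.NeBot] {A : NonzeroFractionalIdeal D K} {x : K}
    {hx : x ≠ 0} (h : A ≤ principal x hx) :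
    limitSubmodule l A ≤ ((principal x hx : NonzeroFractionalIdeal D K).1 : Submodule D K) := by
  rintro y ⟨B, -, hBA, hy⟩
  obtain ⟨s, hs⟩ := hy.exists
  exact s.toFun_le_principal (hBA.trans h) hs

theorem mul_mem_limitSubmodule_scale {A : NonzeroFractionalIdeal D K} {x : K} (hx : x ≠ 0) {y : K}
    (hy : y ∈ limitSubmodule l A) : x * y ∈ limitSubmodule l (scale x hx A) := by
  obtain ⟨B, hB, hBA, hy⟩ := hy
  refine ⟨scale x hx B, fg_scale hx hB, scale_mono hx hBA, hy.mono fun s hs => ?_⟩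
  rw [s.map_scale, mem_scale_iff_inv_mul_mem, inv_mul_cancel_left₀ hx]
  exact hs

/-- Each of the finitely many generators of `B` has its own witness; the sum of these serves for all
of them. This is the core of idempotence. -/
theorem exists_fg_eventually_le {A B : NonzeroFractionalIdeal D K}
    (hB : (B.1 : Submodule D K).FG) (h : (B.1 : Submodule D K) ≤ limitSubmodule l A) :
    ∃ C : NonzeroFractionalIdeal D K,
      (C.1 : Submodule D K).FG ∧ C ≤ A ∧ ∀ᶠ s in l, B ≤ toFun s C := by
  classical
  obtain ⟨T, hT⟩ := hB
  have key : ∀ T : Finset K, (T : Set K) ⊆ limitSubmodule l A → ∃ C : NonzeroFractionalIdeal D K,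
      (C.1 : Submodule D K).FG ∧ C ≤ A ∧ ∀ᶠ s in l, (T : Set K) ⊆ (toFun s C).1 := by
    intro T
    induction T using Finset.induction_on with
    | empty =>
      intro _
      obtain ⟨C, hC, hCA⟩ := A.exists_fg_le
      exact ⟨C, hC, hCA, by simp⟩
    | insert x T _ ih =>
      intro hT
      rw [Finset.coe_insert, Set.insert_subset_iff] at hT
      obtain ⟨C, hC, hCA, hCT⟩ := ih hT.2
      obtain ⟨E, hE, hEA, hEx⟩ := hT.1
      refine ⟨C.add E, fg_add hC hE, add_le hCA hEA, ?_⟩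
      filter_upwards [hCT, hEx] with s h₁ h₂
      rw [Finset.coe_insert, Set.insert_subset_iff]
      exact ⟨s.mono _ _ (le_add_right C E) h₂, h₁.trans (s.mono _ _ (le_add_left C E))⟩
  obtain ⟨C, hC, hCA, hCT⟩ := key T (Submodule.span_le.mp (hT.trans_le h))
  refine ⟨C, hC, hCA, hCT.mono fun s hs => ?_⟩
  have : (B.1 : Submodule D K) ≤ (toFun s C).1 := hT ▸ Submodule.span_le.mpr hs
  exact this

variable (l) [l.NeBot]

/-- The nonzero fractional ideal underlying `limitSubmodule`. -/
def limitIdeal (A : NonzeroFractionalIdeal D K) : NonzeroFractionalIdeal D K :=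
  ⟨⟨limitSubmodule l A, by
    obtain ⟨x, hx, h⟩ := A.exists_le_principal
    exact FractionalIdeal.isFractional_of_le (limitSubmodule_le_principal h)⟩, fun h => by
    obtain ⟨x, hxA, hx⟩ := A.exists_mem_ne_zero
    exact hx (FractionalIdeal.eq_zero_iff.mp h x (le_limitSubmodule A hxA))⟩

variable {l}

theorem mem_limitIdeal {A : NonzeroFractionalIdeal D K} {x : K} :
    x ∈ (limitIdeal l A).1 ↔ x ∈ limitSubmodule l A :=
  Iff.rfl

variable (l)

/-- The finite type star operation sending a finitely generated `A` to the set of elements lying in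
`A^⋆` eventually along `l`. -/
def limit : ClassicalStarOperation D K where
  toFun := limitIdeal l
  map_principal x hx := le_antisymm (limitSubmodule_le_principal le_rfl) (le_limitSubmodule _)
  map_scale x hx A := by
    refine Subtype.ext (FractionalIdeal.ext fun y => ?_)
    rw [mem_scale_iff_inv_mul_mem, mem_limitIdeal, mem_limitIdeal]
    constructor
    · intro h
      have := mul_mem_limitSubmodule_scale (inv_ne_zero hx) h
      rwa [scale_inv_scale] at this
    · intro h
      have := mul_mem_limitSubmodule_scale hx h
      rwa [mul_inv_cancel_left₀ hx] at this
  le_map := le_limitSubmodule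
  mono _ _ := limitSubmodule_mono
  idem A := by
    refine le_antisymm ?_ (le_limitSubmodule _)
    rintro x ⟨B, hB, hBA, hx⟩
    obtain ⟨C, hC, hCA, hBC⟩ := exists_fg_eventually_le hB hBA
    refine ⟨C, hC, hCA, ?_⟩
    -- Eventually `B ⊆ C^s`, so `x ∈ B^s ⊆ (C^s)^s = C^s`.
    filter_upwards [hx, hBC] with s hxs hs
    have := s.mono _ _ hs hxs
    rwa [s.idem] at this

theorem isFiniteType_limit : (limit l).IsFiniteType := fun A => by
  ext x
  constructor
  · rintro ⟨B, hB, hBA, hx⟩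
    exact ⟨B, hB, hBA, (mem_limitSubmodule_of_fg hB).mpr hx⟩
  · rintro ⟨B, -, hBA, hx⟩
    exact limitSubmodule_mono hBA hx

end Limit

end ClassicalStarOperation

/-! ### The topology of `Star_f(D)` -/

namespace FiniteTypeStarOperation

open NonzeroFractionalIdeal ClassicalStarOperation

variable {D K : Type*} [CommRing D] [IsDomain D] [Field K] [Algebra D K] [IsFractionRing D K]

theorem isOpen_setOf_one_mem (F : NonzeroFractionalIdeal D K) :
    IsOpen {s : FiniteTypeStarOperation D K | (1 : K) ∈ (s.1.toFun F).1} :=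
  (isOpen_generateFrom_of_mem ⟨F, rfl⟩ :
    IsOpen {s : ClassicalStarOperation D K | (1 : K) ∈ (s.toFun F).1}).preimage
      continuous_subtype_val

/-- On `Star_f(D)` the sets `U_F` with `F` finitely generated form a subbasis. -/
theorem topology_eq_generateFrom_fg :
    (inferInstance : TopologicalSpace (FiniteTypeStarOperation D K)) =
      generateFrom {U | ∃ F : NonzeroFractionalIdeal D K, (F.1 : Submodule D K).FG ∧
        U = {s : FiniteTypeStarOperation D K | (1 : K) ∈ (s.1.toFun F).1}} := by
  refine le_antisymm (le_generateFrom ?_) ?_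
  · rintro _ ⟨F, -, rfl⟩
    exact isOpen_setOf_one_mem F
  · refine continuous_iff_le_induced.mp (continuous_generateFrom_iff.mpr ?_)
    rintro _ ⟨F, rfl⟩
    let _ := generateFrom {U | ∃ F : NonzeroFractionalIdeal D K, (F.1 : Submodule D K).FG ∧
        U = {s : FiniteTypeStarOperation D K | (1 : K) ∈ (s.1.toFun F).1}}
    -- By finite type, `U_F` is the union of the `U_B` over finitely generated `B ⊆ F`.
    have : (Subtype.val ⁻¹' {s : ClassicalStarOperation D K | (1 : K) ∈ (s.toFun F).1} :
        Set (FiniteTypeStarOperation D K)) =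
        ⋃ B : {B : NonzeroFractionalIdeal D K // (B.1 : Submodule D K).FG ∧ B ≤ F},
          {s : FiniteTypeStarOperation D K | (1 : K) ∈ (s.1.toFun B.1).1} := by
      ext s
      have := Set.ext_iff.mp (s.2 F) 1
      simpa [finiteTypeHull, and_assoc] using this
    rw [this]
    exact isOpen_iUnion fun B => isOpen_generateFrom_of_mem ⟨B.1, B.2.1, rfl⟩

/-- For `x ≠ 0`, `x ∈ A^s` means `1 ∈ (x⁻¹A)^s`, so the sets `U_F` determine the operation. -/
instance : T0Space (FiniteTypeStarOperation D K) := ⟨fun s t h => by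
  refine Subtype.ext (toFun_injective (funext fun A => Subtype.ext (FractionalIdeal.ext
    fun x => ?_)))
  by_cases hx : x = 0
  · simp [hx, FractionalIdeal.zero_mem]
  · rw [mem_toFun_iff_one_mem _ _ hx, mem_toFun_iff_one_mem _ _ hx]
    exact h.mem_open_iff (isOpen_setOf_one_mem _)⟩

end FiniteTypeStarOperation

theorem mainTheorem11 (D K : Type*) [CommRing D] [IsDomain D] [Field K] [Algebra D K]
    [IsFractionRing D K] : SpectralSpace (FiniteTypeStarOperation D K) := by
  refine .of_forall_ultrafilter FiniteTypeStarOperation.topology_eq_generateFrom_fg fun U => ?_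
  refine ⟨⟨.limit ((U : Filter (FiniteTypeStarOperation D K)).map Subtype.val),
    ClassicalStarOperation.isFiniteType_limit _⟩, ?_⟩
  rintro _ ⟨F, hF, rfl⟩
  exact ClassicalStarOperation.mem_limitSubmodule_of_fg hF
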